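/- Let $d\ge 1$ and $n\ge d+1$ be integers. A simplicial complex on $[n]=\{1,\dots,n\}$ is a family of subsets of $[n]$ closed under taking subsets; its $k$-simplices are its members with $k+1$ elements, $f_k(\Sigma)$ is the number of $k$-simplices of $\Sigma$, and $\Sigma$ is $d$-dimensional if $d$ is the largest $k$ for which $\Sigma$ has a $k$-simplex ($\Sigma$ need not be pure). For $p=(p(1),\dots,p(n))\in(\mathbb{R}^d)^n$ let $R(p)$ be the Jacobian matrix at $p$ of the map $(\mathbb{R}^d)^n\to\mathbb{R}^{\binom{[n]}{d+1}}$ sending $q$ to the signed volumes $$\det\begin{pmatrix}1&\cdots&1\\ q(i_1)&\cdots&q(i_{d+1})\end{pmatrix},\qquad 1\le i_1<\dots<i_{d+1}\le n.$$ Call $p$ generic if no nonzero polynomial with rational coefficients in $dn$ variables vanishes at $p$. The $d$-volume rigidity matroid $\mathcal{R}_n^d$ is the matroid on $\binom{[n]}{d+1}$ in which a set is independent if the corresponding rows of $R(p)$ are linearly independent, where $p$ is generic; it does not depend on the choice of the generic $p$. The lexicographically greedy rigid complex (LGRC) $\Lambda$ is the complex whose faces are the subsets of the $(d+1)$-sets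 in the lexicographically greedy basis of $\mathcal{R}_n^d$, that is, of those $S\in\binom{[n]}{d+1}$ that do not lie in the closure, in $\mathcal{R}_n^d$, of the set of lexicographically smaller elements of $\binom{[n]}{d+1}$. **Theorem.** (a) Let $\Sigma$ be a $d$-dimensional simplicial complex on $[n]$ whose set of $d$-simplices is a basis of $\mathcal{R}_n^d$. Then, for all $0\le k\le d$, $$f_k(\Sigma)\ \ge\ \binom{d+1}{k+1}+\sum_{l=0}^{d-1}(n-d-1)\binom{d-l}{k-l},$$ where a binomial coefficient with negative lower entry is $0$. (b) The bound is sharp: the LGRC $\Lambda$ is a $d$-dimensional complex whose set of $d$-simplices is a basis of $\mathcal{R}_n^d$, and $f_k(\Lambda)$ equals the right-hand side for every $0\le k\le d$. -/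

import Mathlib

namespace VolumeRigidity

/-- A `k`-simplex on the vertex set `Fin n`: a set of `k + 1` vertices. -/
abbrev Simplex (n k : ℕ) : Type := {S : Finset (Fin n) // S.card = k + 1}

/-- The vertices of a `k`-simplex, listed in increasing order. -/
def Simplex.vertex {n k : ℕ} (S : Simplex n k) : Fin (k + 1) → Fin n :=
  S.1.orderEmbOfFin S.2

/-- The lexicographic order on `k`-simplices, regarded as increasing tuples. -/
def Simplex.LexLT {n k : ℕ} (S T : Simplex n k) : Prop :=
  toLex S.vertex < toLex T.vertex

/-! ### Simplicial complexes

A simplicial complex with vertices among `Fin n` is a `PreAbstractSimplicialComplex (Fin n)`: a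
family of nonempty subsets of `Fin n` closed under passing to nonempty subsets. Neither purity nor
the presence of every vertex of `Fin n` is required. -/

/-- The set of `k`-simplices of a simplicial complex. -/
def simplices {n : ℕ} (K : PreAbstractSimplicialComplex (Fin n)) (k : ℕ) : Set (Simplex n k) :=
  {S | S.1 ∈ K.faces}

/-- The face number `f_k`: the number of `k`-simplices. -/
noncomputable def faceNumber {n : ℕ} (K : PreAbstractSimplicialComplex (Fin n)) (k : ℕ) : ℕ :=
  (simplices K k).ncard

/-- `K` is `d`-dimensional: `d` is the largest `k` such that `K` has a `k`-simplex. -/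
def HasDimension {n : ℕ} (K : PreAbstractSimplicialComplex (Fin n)) (d : ℕ) : Prop :=
  IsGreatest {k | (simplices K k).Nonempty} d

/-- The simplicial complex whose faces are the nonempty subsets of the members of a given set of
`d`-simplices. -/
def generatedBy {n d : ℕ} (F : Set (Simplex n d)) : PreAbstractSimplicialComplex (Fin n) where
  faces := {A | A.Nonempty ∧ ∃ S ∈ F, A ⊆ S.1}
  isRelLowerSet_faces := by
    rintro A ⟨hA, S, hS, hAS⟩
    exact ⟨hA, fun B hBA hB => ⟨hB, S, hS, le_trans hBA hAS⟩⟩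

/-! ### Volumes and the rigidity matrix -/

/-- A configuration of `n` points in `ℝ^d`, given by coordinates. -/
abbrev Configuration (n d : ℕ) : Type := Fin n → Fin d → ℝ

/-- The matrix with columns `(1, p(i₁)), …, (1, p(i_{d+1}))`, where `i₁ < ⋯ < i_{d+1}` are the
vertices of `S`, over any commutative ring. -/
def configurationMatrix {R : Type} [CommRing R] {n d : ℕ} (p : Fin n → Fin d → R)
    (S : Simplex n d) : Matrix (Fin (d + 1)) (Fin (d + 1)) R :=
  Matrix.of fun r c => (Fin.cons 1 (p (S.vertex c)) : Fin (d + 1) → R) r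

/-- The signed volume of the simplex `S` in the configuration `p` (in the normalization without the
factor `1 / d!`): the `S`-coordinate of the complete volume measurement map. -/
noncomputable def signedVolume {n d : ℕ} (p : Configuration n d) (S : Simplex n d) : ℝ :=
  (configurationMatrix p S).det

/-- The complete rigidity matrix: the Jacobian matrix at `p` of the complete volume measurement map
`q ↦ (signedVolume q S)_S`. The entry at `(S, (i, c))` is the partial derivative of the volume
of `S` in the `c`-th coordinate of the `i`-th point. -/
noncomputable def rigidityMatrix {n d : ℕ} (p : Configuration n d) :
    Matrix (Simplex n d) (Fin n × Fin d) ℝ :=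
  Matrix.of fun S x =>
    fderiv ℝ (fun q : Configuration n d => signedVolume q S) p (Pi.single x.1 (Pi.single x.2 1))

/-! ### The rigidity matroid -/

/-- The row matroid of a real matrix: a set of row indices is independent if the rows that it
indexes are linearly independent. -/
noncomputable def rowMatroid {α κ : Type} [Finite α] (A : Matrix α κ ℝ) : Matroid α :=
  (IndepMatroid.ofFinite (E := Set.univ) Set.finite_univ (fun I => LinearIndepOn ℝ A.row I)
    (linearIndepOn_empty ℝ _)
    (fun _ _ hJ hIJ => hJ.mono hIJ)
    (by
      intro I J hI hJ hIJ
      by_contra hcon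
      push Not at hcon
      have hsub : A.row '' J ⊆ Submodule.span ℝ (A.row '' I) := by
        rintro _ ⟨e, he, rfl⟩
        by_cases heI : e ∈ I
        · exact Submodule.subset_span ⟨e, heI, rfl⟩
        · by_contra hns
          exact hcon e he heI ((linearIndepOn_insert heI).2 ⟨hI, hns⟩)
      have hle : Submodule.span ℝ (A.row '' J) ≤ Submodule.span ℝ (A.row '' I) :=
        Submodule.span_le.2 hsub
      have card : ∀ K : Set α, LinearIndepOn ℝ A.row K →
          Module.finrank ℝ (Submodule.span ℝ (A.row '' K)) = K.ncard := by
        intro K hK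
        have := Fintype.ofFinite K
        have h := finrank_span_eq_card (R := ℝ) (b := fun i : K => A.row i) hK
        rw [Set.range_comp' A.row, Subtype.range_coe] at h
        rw [h, Set.ncard_eq_toFinset_card', Set.toFinset_card]
      have : FiniteDimensional ℝ (Submodule.span ℝ (A.row '' I)) :=
        FiniteDimensional.span_of_finite ℝ (Set.toFinite _)
      have := Submodule.finrank_mono hle
      rw [card I hI, card J hJ] at this
      omega)
    (fun _ _ => Set.subset_univ _)).matroid

theorem rowMatroid_indep_iff {α κ : Type} [Finite α] (A : Matrix α κ ℝ) (I : Set α) :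
    (rowMatroid A).Indep I ↔ LinearIndepOn ℝ A.row I := Iff.rfl

/-- A configuration is generic if no nonzero polynomial with rational coefficients vanishes at it. -/
def IsGeneric {n d : ℕ} (p : Configuration n d) : Prop :=
  ∀ f : MvPolynomial (Fin n × Fin d) ℚ,
    f ≠ 0 → MvPolynomial.aeval (fun x : Fin n × Fin d => p x.1 x.2) f ≠ 0

/-- Generic configurations exist. -/
theorem exists_isGeneric (n d : ℕ) : ∃ p : Configuration n d, IsGeneric p := by
  obtain ⟨s, hs⟩ := exists_isTranscendenceBasis ℚ ℝ
  have hinf : Infinite s := by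
    by_contra hfin
    rw [not_infinite_iff_finite] at hfin
    have halg : Algebra.IsAlgebraic (Algebra.adjoin ℚ (Set.range ((↑) : s → ℝ))) ℝ :=
      hs.isAlgebraic
    have h1 := Algebra.IsAlgebraic.cardinalMk_le_max
      (Algebra.adjoin ℚ (Set.range ((↑) : s → ℝ))) ℝ
    have h2 : Countable (Algebra.adjoin ℚ (Set.range ((↑) : s → ℝ))) := by
      have : Countable (MvPolynomial s ℚ) := by
        rw [← Cardinal.mk_le_aleph0_iff]
        refine MvPolynomial.cardinalMk_le_max.trans ?_
        simp
      exact hs.1.aevalEquiv.toEquiv.symm.injective.countable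
    have h3 : Cardinal.mk ℝ ≤ Cardinal.aleph0 :=
      h1.trans (max_le (Cardinal.mk_le_aleph0_iff.2 h2) le_rfl)
    rw [Cardinal.mk_real] at h3
    exact absurd h3 (not_le.2 Cardinal.aleph0_lt_continuum)
  obtain ⟨e⟩ : Nonempty (Fin n × Fin d ↪ s) := by
    obtain ⟨t, ht⟩ := Infinite.exists_subset_card_eq s (Fintype.card (Fin n × Fin d))
    exact ⟨(Fintype.equivOfCardEq (by simpa using ht.symm)).toEmbedding.trans
      (Function.Embedding.subtype (· ∈ t))⟩
  refine ⟨fun i c => (e (i, c) : ℝ), fun f hf h0 => hf ?_⟩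
  exact (injective_iff_map_eq_zero _).1 (hs.1.comp e e.injective) f h0

/-- A generic configuration. -/
noncomputable def genericConfiguration (n d : ℕ) : Configuration n d :=
  (exists_isGeneric n d).choose

/-- The `d`-dimensional volume rigidity matroid on the `d`-simplices with vertices in `Fin n`: the
row matroid of the complete rigidity matrix at a generic configuration. By
`rowMatroid_eq_rigidityMatroid` below, it does not depend on the generic configuration. -/
noncomputable def rigidityMatroid (n d : ℕ) : Matroid (Simplex n d) :=
  rowMatroid (rigidityMatrix (genericConfiguration n d))

theorem hasFDerivAt_aeval {n d : ℕ} (f : MvPolynomial (Fin n × Fin d) ℚ) (p : Configuration n d) :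
    ∃ L : Configuration n d →L[ℝ] ℝ,
      HasFDerivAt (fun q : Configuration n d =>
        MvPolynomial.aeval (fun x : Fin n × Fin d => q x.1 x.2) f) L p ∧
      ∀ x : Fin n × Fin d, L (Pi.single x.1 (Pi.single x.2 1)) =
        MvPolynomial.aeval (fun y : Fin n × Fin d => p y.1 y.2) (MvPolynomial.pderiv x f) := by
  induction f using MvPolynomial.induction_on with
  | C a => exact ⟨0, by simpa using hasFDerivAt_const _ _, by simp⟩
  | add f g hf hg =>
    obtain ⟨L, hL, hL'⟩ := hf
    obtain ⟨M, hM, hM'⟩ := hg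
    refine ⟨L + M, by simpa using! hL.add hM, fun x => ?_⟩
    simp [hL', hM']
  | mul_X f y hf =>
    obtain ⟨L, hL, hL'⟩ := hf
    have hX : HasFDerivAt (fun q : Configuration n d => q y.1 y.2)
        ((ContinuousLinearMap.proj (R := ℝ) y.2).comp
          (ContinuousLinearMap.proj (R := ℝ) (φ := fun _ : Fin n => Fin d → ℝ) y.1)) p :=
      ContinuousLinearMap.hasFDerivAt
        ((ContinuousLinearMap.proj (R := ℝ) y.2).comp
          (ContinuousLinearMap.proj (R := ℝ) (φ := fun _ : Fin n => Fin d → ℝ) y.1))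
    refine ⟨_, by simpa using! hL.mul hX, fun x => ?_⟩
    have hs : (Pi.single x.1 (Pi.single x.2 (1 : ℝ)) : Configuration n d) y.1 y.2
        = MvPolynomial.aeval (fun z : Fin n × Fin d => p z.1 z.2)
          (Pi.single (M := fun _ => MvPolynomial (Fin n × Fin d) ℚ) x 1 y) := by
      obtain ⟨i, c⟩ := x
      obtain ⟨j, b⟩ := y
      by_cases h1 : j = i
      · subst h1
        by_cases h2 : b = c
        · subst h2; simp
        · simp [h2]
      · simp [h1]
    simp [hL', Derivation.leibniz, MvPolynomial.pderiv_X, hs]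

/-- The rigidity matrix is the evaluation of a fixed matrix of rational polynomials. -/
theorem exists_symbolic_rigidityMatrix (n d : ℕ) :
    ∃ A : Simplex n d → Fin n × Fin d → MvPolynomial (Fin n × Fin d) ℚ,
      ∀ (p : Configuration n d) (S : Simplex n d) (x : Fin n × Fin d),
        rigidityMatrix p S x = MvPolynomial.aeval (fun y : Fin n × Fin d => p y.1 y.2) (A S x) := by
  refine ⟨fun S x => MvPolynomial.pderiv x
    (configurationMatrix (fun i c => MvPolynomial.X (i, c)) S).det, fun p S x => ?_⟩
  have hvol : (fun q : Configuration n d => signedVolume q S) = fun q : Configuration n d =>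
      MvPolynomial.aeval (fun y : Fin n × Fin d => q y.1 y.2)
        (configurationMatrix (fun i c => MvPolynomial.X (R := ℚ) (i, c)) S).det := by
    funext q
    rw [AlgHom.map_det, signedVolume]
    congr 1
    ext r c
    refine Fin.cases ?_ (fun r => ?_) r <;> simp [configurationMatrix]
  obtain ⟨L, hL, hL'⟩ := hasFDerivAt_aeval
    (configurationMatrix (fun i c => MvPolynomial.X (R := ℚ) (i, c)) S).det p
  rw [rigidityMatrix, Matrix.of_apply, hvol, hL.fderiv, hL']

/-- The row matroids of the rigidity matrices at all generic configurations agree. -/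
theorem rowMatroid_eq_rigidityMatroid {n d : ℕ} {p : Configuration n d} (hp : IsGeneric p) :
    rowMatroid (rigidityMatrix p) = rigidityMatroid n d := by
  obtain ⟨A, hA⟩ := exists_symbolic_rigidityMatrix n d
  have key : ∀ q : Configuration n d, IsGeneric q → ∀ I : Set (Simplex n d),
      LinearIndepOn ℝ (rigidityMatrix q).row I ↔
        LinearIndepOn (MvPolynomial (Fin n × Fin d) ℚ) A I := by
    intro q hq I
    let φ := (MvPolynomial.aeval (R := ℚ) (fun y : Fin n × Fin d => q y.1 y.2)).toRingHom
    let : Algebra (MvPolynomial (Fin n × Fin d) ℚ) ℝ := φ.toAlgebra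
    have hinj : Function.Injective (algebraMap (MvPolynomial (Fin n × Fin d) ℚ) ℝ) :=
      (injective_iff_map_eq_zero _).2 fun f h0 => by
        by_contra hf
        exact hq f hf h0
    have : FaithfulSMul (MvPolynomial (Fin n × Fin d) ℚ) ℝ :=
      (faithfulSMul_iff_algebraMap_injective _ _).2 hinj
    have h := linearIndependent_algebraMap_comp_iff (R := MvPolynomial (Fin n × Fin d) ℚ) (S := ℝ)
      (v := fun i : I => A i)
    rw [LinearIndepOn, LinearIndepOn, ← h]
    have heq : (fun i : I => (rigidityMatrix q).row i) =
        fun i : I => algebraMap (MvPolynomial (Fin n × Fin d) ℚ) ℝ ∘ A i := by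
      funext i x
      exact hA q i x
    rw [heq]
  refine Matroid.ext_indep rfl fun I _ => ?_
  rw [rigidityMatroid, rowMatroid_indep_iff, rowMatroid_indep_iff, key p hp,
    key (genericConfiguration n d) (exists_isGeneric n d).choose_spec]

/-! ### The lexicographically greedy rigid complex -/

/-- The lexicographically greedy basis of the rigidity matroid: run through the `d`-simplices in
lexicographic order and keep a simplex exactly when it is not spanned, in the matroid, by the
simplices before it. -/
def lexGreedyBasis (n d : ℕ) : Set (Simplex n d) :=
  {S | S ∉ (rigidityMatroid n d).closure {T | T.LexLT S}}

/-- The lexicographically greedy rigid complex. -/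
def lgrc (n d : ℕ) : PreAbstractSimplicialComplex (Fin n) :=
  generatedBy (lexGreedyBasis n d)

/-! ### The bound -/

/-- The number `C(d+1, k+1) + ∑_{l=0}^{d-1} (n-d-1) C(d-l, k-l)`, to be used for `d + 1 ≤ n`; a
binomial coefficient with negative lower entry `k - l` is zero. -/
def faceBound (n d k : ℕ) : ℕ :=
  (d + 1).choose (k + 1) +
    ∑ l ∈ Finset.range d, (n - d - 1) * (if l ≤ k then (d - l).choose (k - l) else 0)

end VolumeRigidity

/-!
Let `I` be the initial simplex, on the vertices `0, …, d`. The model complex has as `d`-simplices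
`I` and the sets `I - i + j` with `0 < i ≤ d < j`, and as `k`-simplices, for `k < d`, all sets with
at most one vertex outside `I` (`modelFaces`). Counting shows that it attains the bound
(`card_modelFaces`). Both halves of the theorem compare complexes with this one.

Everything rests on a description of the motions `v` of a generic configuration in terms of the
volumes that they preserve to first order (`exists_barycentric_motion`). If `v` preserves the volume
of `I`, subtracting an affine motion that preserves all volumes makes `v` vanish on `I`. Then the
volume of `I - i + j` changes by a nonzero multiple of the `i`-th barycentric coordinate of the
displacement of `j`, where the coordinates of a displacement sum to zero. So preserving the volume
of `I - i + j` for every `i` outside a set `F ⊆ I` makes `j` move parallel to `F`, which preserves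
the volumes of the simplices whose intersection with `I` contains `F`.

*The greedy complex.* Suppose that `S` has two vertices outside `I`. Then every `I - i + j` with
`i ∉ S` precedes `S` lexicographically, and so does `I`; by the above these simplices span `S`.
If `S` does not contain the vertex `0`, then it is spanned by the simplices `I` and `I - i + j` with
`0 < i`, which precede it. Hence the greedy basis consists of model faces
(`lexGreedyBasis_subset_modelFaces`), and the face numbers of the greedy complex are at most the
bound.

*The lower bound.* Let `M` be the square matrix whose rows are the all-ones row and the coordinate
rows of the configuration, completed by the unit rows `e_j` for `j > d`. For a complex `K` whose
`d`-simplices form a basis, the vectors of minors `(det M[A, B])_B`, with `B` running through the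
`k`-simplices of `K`, are linearly independent for `A` in the model `k`-faces. For `k = d`
(`minorsIndependent_of_isBase`) these minors are the derivatives of volumes along motions, and a
combination that vanishes on a basis vanishes on all simplices. For smaller `k`
(`MinorsIndependent.of_succ`) a relation is multiplied, in the exterior algebra, by a row `x ≤ d`.
Relations on `K` persist, by Laplace expansion, and the products of the model faces that do not
contain `x` are again model faces. For `k + 1 = d` a product is a model face only if it contains the
vertex `0`, so the row `0` is used first. Comparing dimensions, `K` has at least as many
`k`-simplices as the model complex.
-/

namespace VolumeRigidity

open Matrix

/-! ### The derivative of the volumes -/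

/-- The derivative of the determinant at `X` in the direction `Y`. -/
def detDeriv {m : Type*} [Fintype m] [DecidableEq m] (X Y : Matrix m m ℝ) : ℝ :=
  (adjugate X * Y).trace

theorem detDeriv_eq_sum_updateCol {m : Type*} [Fintype m] [DecidableEq m] (X Y : Matrix m m ℝ) :
    detDeriv X Y = ∑ c, (X.updateCol c fun r => Y r c).det := by
  refine Finset.sum_congr rfl fun c _ => ?_
  rw [← cramer_apply, cramer_eq_adjugate_mulVec]
  rfl

theorem detDeriv_updateRow {m : Type*} [Fintype m] [DecidableEq m] (X : Matrix m m ℝ) (i : m)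
    (y : m → ℝ) : detDeriv X ((0 : Matrix m m ℝ).updateRow i y) = (X.updateRow i y).det := by
  rw [detDeriv, trace_mul_comm, ← cramer_transpose_apply, cramer_eq_adjugate_mulVec,
    ← adjugate_transpose, trace, Finset.sum_eq_single i]
  · simp [mul_apply, mulVec, dotProduct, mul_comm]
  · intro j _ hj
    simp [mul_apply, hj]
  · simp

theorem detDeriv_mul_left {m : Type*} [Fintype m] [DecidableEq m] (Z X Y : Matrix m m ℝ) :
    detDeriv (Z * X) (Z * Y) = Z.det * detDeriv X Y := by
  rw [detDeriv, detDeriv, adjugate_mul_distrib, Matrix.mul_assoc, ← Matrix.mul_assoc Z.adjugate,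
    adjugate_mul]
  simp

theorem detDeriv_mul_self {m : Type*} [Fintype m] [DecidableEq m] (B X : Matrix m m ℝ) :
    detDeriv X (B * X) = B.trace * X.det := by
  rw [detDeriv, ← Matrix.mul_assoc, trace_mul_comm, ← Matrix.mul_assoc, mul_adjugate]
  simp [mul_comm]

theorem detDeriv_add {m : Type*} [Fintype m] [DecidableEq m] (X Y Z : Matrix m m ℝ) :
    detDeriv X (Y + Z) = detDeriv X Y + detDeriv X Z := by
  simp [detDeriv, Matrix.mul_add]

theorem detDeriv_smul {m : Type*} [Fintype m] [DecidableEq m] (X Y : Matrix m m ℝ) (a : ℝ) :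
    detDeriv X (a • Y) = a * detDeriv X Y := by
  simp [detDeriv]

/-- The determinant as a continuous multilinear function of the rows. -/
noncomputable def detMultilinear (m : ℕ) :
    ContinuousMultilinearMap ℝ (fun _ : Fin m => Fin m → ℝ) ℝ where
  toMultilinearMap := (detRowAlternating (R := ℝ) (n := Fin m)).toMultilinearMap
  cont := Continuous.matrix_det (A := fun v : Fin m → Fin m → ℝ => v) continuous_id

/-- The points of a configuration in homogeneous coordinates: the column of `x` is `(1, p x)`. -/
def homogeneousMatrix {n d : ℕ} (p : Configuration n d) : Matrix (Fin (d + 1)) (Fin n) ℝ :=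
  Matrix.of fun r x => (Fin.cons 1 (p x) : Fin (d + 1) → ℝ) r

/-- The velocities of a motion in homogeneous coordinates: the column of `x` is `(0, v x)`. -/
def velocityMatrix {n d : ℕ} (v : Configuration n d) : Matrix (Fin (d + 1)) (Fin n) ℝ :=
  Matrix.of fun r x => (Fin.cons 0 (v x) : Fin (d + 1) → ℝ) r

theorem fderiv_signedVolume {n d : ℕ} (p v : Configuration n d) (S : Simplex n d) :
    fderiv ℝ (fun q : Configuration n d => signedVolume q S) p v =
      detDeriv ((homogeneousMatrix p).submatrix id S.vertex)
        ((velocityMatrix v).submatrix id S.vertex) := by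
  -- the affine map `q ↦ (1, q x)` and its linear part
  let g' : Fin (d + 1) → Configuration n d →L[ℝ] (Fin (d + 1) → ℝ) := fun c =>
    ContinuousLinearMap.pi fun r => Fin.cases (motive := fun _ => Configuration n d →L[ℝ] ℝ) 0
      (fun r => (ContinuousLinearMap.proj (R := ℝ) (φ := fun _ : Fin d => ℝ) r).comp
        (ContinuousLinearMap.proj (R := ℝ) (φ := fun _ : Fin n => Fin d → ℝ) (S.vertex c))) r
  have hg : ∀ c, HasFDerivAt (fun q : Configuration n d =>
      (Fin.cons 1 (q (S.vertex c)) : Fin (d + 1) → ℝ)) (g' c) p := by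
    intro c
    rw [hasFDerivAt_pi']
    intro r
    refine Fin.cases ?_ (fun r => ?_) r
    · exact hasFDerivAt_const (1 : ℝ) p
    · exact ContinuousLinearMap.hasFDerivAt
        ((ContinuousLinearMap.proj (R := ℝ) (φ := fun _ : Fin d => ℝ) r).comp
        (ContinuousLinearMap.proj (R := ℝ) (φ := fun _ : Fin n => Fin d → ℝ) (S.vertex c)))
  have hvol : (fun q : Configuration n d => signedVolume q S) = fun q : Configuration n d =>
      detMultilinear (d + 1) fun c => (Fin.cons 1 (q (S.vertex c)) : Fin (d + 1) → ℝ) := by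
    funext q
    rw [signedVolume, ← det_transpose]
    rfl
  have hcol : ∀ c, g' c v = fun r => velocityMatrix v r (S.vertex c) := by
    intro c
    funext r
    refine Fin.cases ?_ (fun r => ?_) r <;> simp [g', velocityMatrix]
  rw [hvol, (HasFDerivAt.multilinear_comp (detMultilinear (d + 1)) hg).fderiv,
    detDeriv_eq_sum_updateCol]
  simp only [_root_.sum_apply, ContinuousLinearMap.comp_apply]
  refine Finset.sum_congr rfl fun c _ => ?_
  rw [← det_transpose, ← updateRow_transpose]
  simp only [submatrix_apply, id, ← hcol]
  rfl

theorem rigidityMatrix_dotProduct {n d : ℕ} (p v : Configuration n d) (S : Simplex n d) :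
    ∑ x, rigidityMatrix p S x * v x.1 x.2 =
      detDeriv ((homogeneousMatrix p).submatrix id S.vertex)
        ((velocityMatrix v).submatrix id S.vertex) := by
  rw [← fderiv_signedVolume]
  have hv : v = ∑ x : Fin n × Fin d, v x.1 x.2 •
      (Pi.single x.1 (Pi.single x.2 1) : Configuration n d) := by
    funext i c
    rw [Finset.sum_apply, Finset.sum_apply, Finset.sum_eq_single (i, c)]
    · simp
    · rintro ⟨j, b⟩ - hne
      by_cases hj : j = i
      · subst hj
        have hb : c ≠ b := fun h => hne (h ▸ rfl)
        simp [hb]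
      · simp [Ne.symm hj]
    · simp
  conv_rhs => rw [hv, map_sum]
  refine Finset.sum_congr rfl fun x _ => ?_
  rw [map_smul, smul_eq_mul, mul_comm]
  rfl

/-! ### Closures in row matroids and greedy bases -/

theorem mem_closure_rowMatroid {α κ : Type} [Finite α] (A : Matrix α κ ℝ) {X : Set α} {e : α}
    (he : A.row e ∈ Submodule.span ℝ (A.row '' X)) : e ∈ (rowMatroid A).closure X := by
  obtain ⟨I, hI⟩ := (rowMatroid A).exists_isBasis X (Set.subset_univ X)
  rw [← hI.closure_eq_closure, hI.indep.mem_closure_iff']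
  refine ⟨Set.mem_univ e, fun hins => ?_⟩
  by_contra heI
  have h := ((linearIndepOn_insert heI).1 ((rowMatroid_indep_iff A _).1 hins)).2
  refine h (Submodule.span_le.2 ?_ he)
  rintro _ ⟨x, hx, rfl⟩
  by_cases hxI : x ∈ I
  · exact Submodule.subset_span ⟨x, hxI, rfl⟩
  · by_contra hns
    have : (rowMatroid A).Indep (insert x I) :=
      (linearIndepOn_insert hxI).2 ⟨hI.indep, hns⟩
    exact hxI (hI.mem_of_insert_indep hx this)

theorem mem_closure_rowMatroid_of_forall {α κ : Type} [Finite α] [Fintype κ] (A : Matrix α κ ℝ)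
    {X : Set α} {e : α}
    (h : ∀ v : κ → ℝ, (∀ t ∈ X, ∑ x, A t x * v x = 0) → ∑ x, A e x * v x = 0) :
    e ∈ (rowMatroid A).closure X := by
  classical
  refine mem_closure_rowMatroid A ?_
  by_contra hns
  obtain ⟨f, hf, hf0⟩ := Submodule.exists_dual_map_eq_bot_of_notMem hns inferInstance
  have hfA : ∀ t, f (A.row t) = ∑ x, A t x * f (Pi.single x 1) := by
    intro t
    conv_lhs => rw [pi_eq_sum_univ' (A.row t), map_sum]
    refine Finset.sum_congr rfl fun x _ => ?_
    rw [map_smul, smul_eq_mul]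
    rfl
  refine hf ?_
  rw [hfA]
  refine h _ fun t ht => ?_
  rw [← hfA]
  have : f (A.row t) ∈ (Submodule.span ℝ (A.row '' X)).map f :=
    Submodule.mem_map_of_mem (Submodule.subset_span ⟨t, ht, rfl⟩)
  rwa [hf0, Submodule.mem_bot] at this

theorem dotProduct_eq_zero_of_isBase {α κ : Type} [Finite α] [Fintype κ] (A : Matrix α κ ℝ)
    {B : Set α} (hB : (rowMatroid A).IsBase B) (v : κ → ℝ)
    (h : ∀ t ∈ B, ∑ x, A t x * v x = 0) (e : α) : ∑ x, A e x * v x = 0 := by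
  have hker : Submodule.span ℝ (A.row '' B) ≤
      LinearMap.ker (∑ x, v x • LinearMap.proj (R := ℝ) (φ := fun _ : κ => ℝ) x) := by
    refine Submodule.span_le.2 ?_
    rintro _ ⟨t, ht, rfl⟩
    simpa [mul_comm] using h t ht
  have he : A.row e ∈ Submodule.span ℝ (A.row '' B) := by
    by_cases heB : e ∈ B
    · exact Submodule.subset_span ⟨e, heB, rfl⟩
    · by_contra hns
      have : (rowMatroid A).Indep (insert e B) :=
        (linearIndepOn_insert heB).2 ⟨hB.indep, hns⟩
      exact heB (hB.mem_of_insert_indep this)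
  simpa [mul_comm] using hker he

theorem lexGreedyBasis_isBase (n d : ℕ) :
    (rigidityMatroid n d).IsBase (lexGreedyBasis n d) := by
  have hinj : Function.Injective fun S : Simplex n d => toLex S.vertex := by
    intro S T h
    have h' : S.vertex = T.vertex := toLex.injective h
    refine Subtype.ext ?_
    rw [← Finset.coe_inj, ← Finset.range_orderEmbOfFin S.1 S.2,
      ← Finset.range_orderEmbOfFin T.1 T.2]
    exact congrArg Set.range h'
  have hE : (rigidityMatroid n d).E = Set.univ := rfl
  rw [Matroid.isBase_iff_indep_closure_eq]
  constructor
  · rw [Matroid.indep_iff_forall_subset_not_isCircuit (by rw [hE]; exact Set.subset_univ _)]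
    intro C hC hcirc
    -- the last element of a circuit is spanned by the others
    obtain ⟨S, hS, hmax⟩ := Set.exists_max_image C (fun S : Simplex n d => toLex S.vertex)
      (Set.toFinite C) hcirc.nonempty
    refine hC hS (Matroid.closure_subset_closure _ ?_
      (hcirc.mem_closure_sdiff_singleton_of_mem hS))
    rintro T ⟨hT, hne⟩
    exact lt_of_le_of_ne (hmax T hT) fun h => hne (hinj h)
  · refine Set.Subset.antisymm (Matroid.closure_subset_ground _ _) fun S _ => ?_
    have hwf : WellFounded (fun S T : Simplex n d => S.LexLT T) :=
      have := IsTrans.mk (r := fun S T : Simplex n d => S.LexLT T) fun _ _ _ h1 h2 => lt_trans h1 h2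
      have := Std.Irrefl.mk (r := fun S T : Simplex n d => S.LexLT T) fun _ h => lt_irrefl _ h
      Finite.wellFounded_of_trans_of_irrefl _
    induction S using hwf.induction with
    | _ S ih =>
      by_cases hS : S ∈ lexGreedyBasis n d
      · exact Matroid.mem_closure_of_mem' _ hS (Set.mem_univ _)
      · have hS' : S ∈ (rigidityMatroid n d).closure {T | T.LexLT S} := not_not.1 hS
        have hsub : {T | T.LexLT S} ⊆ (rigidityMatroid n d).closure (lexGreedyBasis n d) :=
          fun T hT => ih T hT (Set.mem_univ _)
        exact Matroid.closure_subset_closure_of_subset_closure hsub hS'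

/-- A simplex precedes another as soon as the least vertex at which they differ belongs to it. -/
theorem Simplex.lexLT_of_mem {n k : ℕ} {S T : Simplex n k} {x : Fin n} (hT : x ∈ T.1)
    (hS : x ∉ S.1) (h : ∀ y < x, y ∈ S.1 → y ∈ T.1) : T.LexLT S := by
  have hmem : ∀ (U : Simplex n k) y, y ∈ U.1 ↔ ∃ i, U.vertex i = y := fun U y => by
    rw [← Finset.mem_coe, ← Finset.range_orderEmbOfFin U.1 U.2]
    rfl
  have hmono : ∀ U : Simplex n k, StrictMono U.vertex := fun U =>
    (U.1.orderEmbOfFin U.2).strictMono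
  rcases lt_trichotomy (toLex T.vertex) (toLex S.vertex) with hlt | heq | hlt
  · exact hlt
  · have heq' : T.vertex = S.vertex := toLex.injective heq
    rw [hmem, ← heq', ← hmem] at hS
    exact absurd hT hS
  · exfalso
    obtain ⟨i, hi, hlt⟩ := hlt
    replace hi : ∀ j < i, S.vertex j = T.vertex j := hi
    replace hlt : S.vertex i < T.vertex i := hlt
    have hnT : S.vertex i ∉ T.1 := by
      rw [hmem]
      rintro ⟨j, hj⟩
      rcases lt_or_ge j i with hji | hij
      · rw [← hi j hji] at hj
        exact hji.ne ((hmono S).injective hj)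
      · exact (hlt.trans_le ((hmono T).monotone hij)).ne hj.symm
    obtain ⟨j, rfl⟩ := (hmem T x).1 hT
    have hle : T.vertex j ≤ S.vertex i := by
      by_contra hcon
      exact hnT (h _ (not_le.1 hcon) ((hmem S _).2 ⟨i, rfl⟩))
    have hji : j < i := (hmono T).lt_iff_lt.1 (hle.trans_lt hlt)
    exact hS ((hmem S _).2 ⟨j, hi j hji⟩)

/-! ### The initial simplex and its neighbours -/

/-- The `d`-simplex on the first `d + 1` vertices. -/
def initialSimplex {n d : ℕ} (hn : d + 1 ≤ n) : Simplex n d :=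
  ⟨Finset.univ.map (Fin.castLEEmb hn), by simp⟩

theorem mem_initialSimplex {n d : ℕ} {hn : d + 1 ≤ n} {x : Fin n} :
    x ∈ (initialSimplex hn).1 ↔ ∃ i, Fin.castLE hn i = x := by
  simp [initialSimplex]

theorem mem_initialSimplex_iff_lt {n d : ℕ} {hn : d + 1 ≤ n} {x : Fin n} :
    x ∈ (initialSimplex hn).1 ↔ x.1 < d + 1 := by
  rw [mem_initialSimplex]
  constructor
  · rintro ⟨i, rfl⟩
    exact i.2
  · exact fun h => ⟨⟨x.1, h⟩, rfl⟩

theorem castLE_mem_initialSimplex {n d : ℕ} {hn : d + 1 ≤ n} (i : Fin (d + 1)) :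
    Fin.castLE hn i ∈ (initialSimplex hn).1 :=
  mem_initialSimplex.2 ⟨i, rfl⟩

theorem vertex_initialSimplex {n d : ℕ} (hn : d + 1 ≤ n) :
    (initialSimplex hn).vertex = Fin.castLE hn := by
  refine (Finset.orderEmbOfFin_unique _ (fun i => castLE_mem_initialSimplex i) ?_).symm
  exact Fin.strictMono_castLE hn

theorem Simplex.vertex_injective {n k : ℕ} (S : Simplex n k) : Function.Injective S.vertex :=
  (S.1.orderEmbOfFin S.2).injective

theorem Simplex.mem_iff_exists_vertex {n k : ℕ} (S : Simplex n k) {x : Fin n} :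
    x ∈ S.1 ↔ ∃ c, S.vertex c = x := by
  rw [← Finset.mem_coe, ← Finset.range_orderEmbOfFin S.1 S.2]
  rfl

/-- The `d`-simplex obtained from the initial one by exchanging its `i`-th vertex for a vertex `j`
outside. -/
def exchange {n d : ℕ} (hn : d + 1 ≤ n) (i : Fin (d + 1)) (j : Fin n)
    (hj : j ∉ (initialSimplex hn).1) : Simplex n d :=
  ⟨insert j ((initialSimplex hn).1.erase (Fin.castLE hn i)), by
    rw [Finset.card_insert_of_notMem fun h => hj (Finset.mem_of_mem_erase h),
      Finset.card_erase_of_mem (castLE_mem_initialSimplex i), (initialSimplex hn).2]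
    omega⟩

/-! ### Motions in barycentric coordinates -/

/-- The displacement of the vertex `j` outside the initial simplex can be read off from the volumes
of the neighbours of the initial simplex at `j`, in barycentric coordinates `Q`. -/
theorem apply_eq_zero_of_detDeriv_exchange {n d : ℕ} {hn : d + 1 ≤ n}
    {Q U : Matrix (Fin (d + 1)) (Fin n) ℝ}
    (hQ : Q.submatrix id (Fin.castLE hn) = 1) (hU : U.submatrix id (Fin.castLE hn) = 0)
    {i : Fin (d + 1)} {j : Fin n} (hj : j ∉ (initialSimplex hn).1)
    (h : detDeriv (Q.submatrix id (exchange hn i j hj).vertex)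
      (U.submatrix id (exchange hn i j hj).vertex) = 0) : U i j = 0 := by
  set T := exchange hn i j hj with hT
  obtain ⟨c, hc⟩ := T.mem_iff_exists_vertex.1 (Finset.mem_insert_self j _)
  rw [detDeriv_eq_sum_updateCol, Finset.sum_eq_single c] at h
  · obtain ⟨y, hy0, hy⟩ := exists_vecMul_eq_zero_iff.2 h
    have hyk : ∀ k, k ≠ i → y k = 0 := by
      intro k hk
      have hkT : Fin.castLE hn k ∈ T.1 := by
        refine Finset.mem_insert_of_mem (Finset.mem_erase.2 ⟨?_, castLE_mem_initialSimplex k⟩)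
        exact fun h => hk (Fin.castLE_injective hn h)
      obtain ⟨c', hc'⟩ := T.mem_iff_exists_vertex.1 hkT
      have hne : c' ≠ c := by
        rintro rfl
        exact hj (hc ▸ hc' ▸ castLE_mem_initialSimplex k)
      have := congrFun hy c'
      simp only [vecMul, dotProduct, updateCol_apply, hne, if_false, submatrix_apply, id, hc',
        Pi.zero_apply] at this
      have hQk : ∀ r, Q r (Fin.castLE hn k) = (1 : Matrix _ _ ℝ) r k := fun r =>
        congrFun (congrFun hQ r) k
      simpa [hQk, one_apply] using this
    have hyi : y i ≠ 0 := by
      intro hyi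
      refine hy0 (funext fun k => ?_)
      by_cases hk : k = i
      · rw [hk, hyi]; rfl
      · exact hyk k hk
    have := congrFun hy c
    simp only [vecMul, dotProduct, updateCol_apply, if_true, submatrix_apply, id, hc,
      Pi.zero_apply] at this
    rw [Finset.sum_eq_single i (fun k _ hk => by rw [hyk k hk, zero_mul]) (by simp)] at this
    exact (mul_eq_zero.1 this).resolve_left hyi
  · intro c' _ hne
    have hmem := T.mem_iff_exists_vertex.2 ⟨c', rfl⟩
    have hlow : T.vertex c' ∈ (initialSimplex hn).1 := by
      rcases Finset.mem_insert.1 hmem with h | h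
      · exact absurd (T.vertex_injective (h.trans hc.symm)) hne
      · exact Finset.mem_of_mem_erase h
    obtain ⟨k, hk⟩ := mem_initialSimplex.1 hlow
    refine det_eq_zero_of_column_eq_zero c' fun r => ?_
    have : U r (Fin.castLE hn k) = 0 := congrFun (congrFun hU r) k
    simp [← hk, this]
  · simp

/-- A displacement of the vertices outside the initial simplex preserves the volume of `S` to first
order if it moves each of them parallel to the face that `S` shares with the initial simplex. -/
theorem detDeriv_eq_zero_of_apply_eq_zero {n d : ℕ} {hn : d + 1 ≤ n}
    {Q U : Matrix (Fin (d + 1)) (Fin n) ℝ}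
    (hQ : Q.submatrix id (Fin.castLE hn) = 1) (hU : U.submatrix id (Fin.castLE hn) = 0)
    (S : Simplex n d)
    (h : ∀ j ∈ S.1, j ∉ (initialSimplex hn).1 → ∀ i, Fin.castLE hn i ∉ S.1 → U i j = 0) :
    detDeriv (Q.submatrix id S.vertex) (U.submatrix id S.vertex) = 0 := by
  rw [detDeriv_eq_sum_updateCol]
  refine Finset.sum_eq_zero fun c _ => ?_
  by_cases hlow : S.vertex c ∈ (initialSimplex hn).1
  · obtain ⟨k, hk⟩ := mem_initialSimplex.1 hlow
    refine det_eq_zero_of_column_eq_zero c fun r => ?_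
    have : U r (Fin.castLE hn k) = 0 := congrFun (congrFun hU r) k
    simp [← hk, this]
  · rw [← cramer_apply]
    have hsum : (fun r => U.submatrix id S.vertex r c) =
        ∑ k, U k (S.vertex c) • (Pi.single k 1 : Fin (d + 1) → ℝ) := by
      funext r
      simp [Finset.sum_apply, Pi.single_apply]
    rw [hsum, map_sum, Finset.sum_apply]
    refine Finset.sum_eq_zero fun k _ => ?_
    rw [map_smul, Pi.smul_apply, cramer_apply]
    by_cases hk : Fin.castLE hn k ∈ S.1
    · obtain ⟨c', hc'⟩ := S.mem_iff_exists_vertex.1 hk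
      have hne : c' ≠ c := by
        rintro rfl
        exact hlow (hc' ▸ castLE_mem_initialSimplex k)
      have : (Pi.single k 1 : Fin (d + 1) → ℝ) = fun r => Q.submatrix id S.vertex r c' := by
        funext r
        have : Q r (Fin.castLE hn k) = (1 : Matrix _ _ ℝ) r k := congrFun (congrFun hQ r) k
        simp [hc', this, one_apply, Pi.single_apply]
      rw [this, det_updateCol_eq_zero hne, smul_zero]
    · rw [h _ (S.mem_iff_exists_vertex.2 ⟨c, rfl⟩) hlow k hk, zero_smul]

/-- A motion `V` that preserves the volume of the initial simplex to first order is, up to an affine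
motion `B` preserving all volumes, a displacement `U` of the vertices outside the initial simplex,
in barycentric coordinates `Q` with respect to that simplex. -/
theorem exists_barycentric_motion {n d : ℕ} {hn : d + 1 ≤ n}
    {P V : Matrix (Fin (d + 1)) (Fin n) ℝ} (hP : (P.submatrix id (Fin.castLE hn)).det ≠ 0)
    (hV : detDeriv (P.submatrix id (Fin.castLE hn)) (V.submatrix id (Fin.castLE hn)) = 0) :
    ∃ Q U : Matrix (Fin (d + 1)) (Fin n) ℝ,
      Q.submatrix id (Fin.castLE hn) = 1 ∧ U.submatrix id (Fin.castLE hn) = 0 ∧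
      (∀ S : Simplex n d,
        detDeriv (P.submatrix id S.vertex) (V.submatrix id S.vertex) =
          (P.submatrix id (Fin.castLE hn)).det *
            detDeriv (Q.submatrix id S.vertex) (U.submatrix id S.vertex)) ∧
      V = (V.submatrix id (Fin.castLE hn) * (P.submatrix id (Fin.castLE hn))⁻¹) * P +
        P.submatrix id (Fin.castLE hn) * U := by
  set P₀ := P.submatrix id (Fin.castLE hn) with hP₀
  set V₀ := V.submatrix id (Fin.castLE hn) with hV₀
  have hunit : IsUnit P₀.det := hP.isUnit
  have hsub : ∀ (Z : Matrix (Fin (d + 1)) (Fin (d + 1)) ℝ) (Y : Matrix (Fin (d + 1)) (Fin n) ℝ)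
      (s : Fin (d + 1) → Fin n), (Z * Y).submatrix id s = Z * Y.submatrix id s :=
    fun _ _ _ => rfl
  have hQP : P₀ * (P₀⁻¹ * P) = P := by
    rw [← Matrix.mul_assoc, mul_nonsing_inv _ hunit, Matrix.one_mul]
  have hdecomp : V = (V₀ * P₀⁻¹) * P + P₀ * (P₀⁻¹ * (V - (V₀ * P₀⁻¹) * P)) := by
    rw [← Matrix.mul_assoc P₀, mul_nonsing_inv _ hunit, Matrix.one_mul]
    abel
  have htr : (V₀ * P₀⁻¹).trace = 0 := by
    have hV' : V₀ = (V₀ * P₀⁻¹) * P₀ := by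
      rw [Matrix.mul_assoc, nonsing_inv_mul _ hunit, Matrix.mul_one]
    rw [hV', detDeriv_mul_self] at hV
    exact (mul_eq_zero.1 hV).resolve_right hP
  refine ⟨P₀⁻¹ * P, P₀⁻¹ * (V - (V₀ * P₀⁻¹) * P), ?_, ?_, fun S => ?_, hdecomp⟩
  · rw [hsub, ← hP₀, nonsing_inv_mul _ hunit]
  · rw [hsub, submatrix_sub, Pi.sub_apply, Pi.sub_apply, hsub, ← hV₀, ← hP₀, Matrix.mul_assoc,
      nonsing_inv_mul _ hunit, Matrix.mul_one, sub_self, Matrix.mul_zero]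
  · conv_lhs => rw [hdecomp]
    rw [submatrix_add, Pi.add_apply, Pi.add_apply, hsub, hsub, detDeriv_add, detDeriv_mul_self,
      htr, zero_mul, zero_add, ← detDeriv_mul_left, ← hsub, ← hsub, hQP]

/-- The volumes of the initial simplex and its neighbours determine the volume of `S` to first
order; the exchanged vertices of the initial simplex may be taken outside of `S`. -/
theorem detDeriv_eq_zero_of_exchange {n d : ℕ} {hn : d + 1 ≤ n}
    {P V : Matrix (Fin (d + 1)) (Fin n) ℝ} (hP : (P.submatrix id (Fin.castLE hn)).det ≠ 0)
    (hV : detDeriv (P.submatrix id (Fin.castLE hn)) (V.submatrix id (Fin.castLE hn)) = 0)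
    (S : Simplex n d)
    (h : ∀ i j (hj : j ∉ (initialSimplex hn).1), Fin.castLE hn i ∉ S.1 →
      detDeriv (P.submatrix id (exchange hn i j hj).vertex)
        (V.submatrix id (exchange hn i j hj).vertex) = 0) :
    detDeriv (P.submatrix id S.vertex) (V.submatrix id S.vertex) = 0 := by
  obtain ⟨Q, U, hQ, hU, hQU, -⟩ := exists_barycentric_motion hP hV
  rw [hQU, detDeriv_eq_zero_of_apply_eq_zero hQ hU S, mul_zero]
  intro j _ hj i hi
  refine apply_eq_zero_of_detDeriv_exchange hQ hU hj ?_
  have := h i j hj hi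
  rw [hQU] at this
  exact (mul_eq_zero.1 this).resolve_left hP

/-- The volumes of the initial simplex and those of its neighbours that contain the first vertex
determine all volumes to first order: barycentric displacements have coordinate sum zero. -/
theorem detDeriv_eq_zero_of_exchange_ne_zero {n d : ℕ} {hn : d + 1 ≤ n}
    {P V : Matrix (Fin (d + 1)) (Fin n) ℝ} (hP : (P.submatrix id (Fin.castLE hn)).det ≠ 0)
    (hP1 : ∀ x, P 0 x = 1) (hV0 : ∀ x, V 0 x = 0)
    (hV : detDeriv (P.submatrix id (Fin.castLE hn)) (V.submatrix id (Fin.castLE hn)) = 0)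
    (S : Simplex n d)
    (h : ∀ i j (hj : j ∉ (initialSimplex hn).1), i ≠ 0 →
      detDeriv (P.submatrix id (exchange hn i j hj).vertex)
        (V.submatrix id (exchange hn i j hj).vertex) = 0) :
    detDeriv (P.submatrix id S.vertex) (V.submatrix id S.vertex) = 0 := by
  obtain ⟨Q, U, hQ, hU, hQU, hdecomp⟩ := exists_barycentric_motion hP hV
  have hne : ∀ j, j ∉ (initialSimplex hn).1 → ∀ i, i ≠ 0 → U i j = 0 := by
    intro j hj i hi
    refine apply_eq_zero_of_detDeriv_exchange hQ hU hj ?_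
    have := h i j hj hi
    rw [hQU] at this
    exact (mul_eq_zero.1 this).resolve_left hP
  have hzero : ∀ j, j ∉ (initialSimplex hn).1 → U 0 j = 0 := by
    intro j hj
    have := congrFun (congrFun hdecomp 0) j
    simp only [Matrix.add_apply, mul_apply, submatrix_apply, id, hV0, hP1, zero_mul,
      Finset.sum_const_zero, zero_add, one_mul] at this
    rw [Finset.sum_eq_single 0 (fun i _ hi => hne j hj i hi) (by simp)] at this
    exact this.symm
  rw [hQU, detDeriv_eq_zero_of_apply_eq_zero hQ hU S, mul_zero]
  intro j _ hj i _
  by_cases hi : i = 0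
  · rw [hi]; exact hzero j hj
  · exact hne j hj i hi

/-- A motion that fixes the initial simplex and preserves all volumes to first order is zero. -/
theorem eq_zero_of_detDeriv_eq_zero {n d : ℕ} {hn : d + 1 ≤ n}
    {P V : Matrix (Fin (d + 1)) (Fin n) ℝ} (hP : (P.submatrix id (Fin.castLE hn)).det ≠ 0)
    (hV : V.submatrix id (Fin.castLE hn) = 0)
    (h : ∀ S : Simplex n d,
      detDeriv (P.submatrix id S.vertex) (V.submatrix id S.vertex) = 0) : V = 0 := by
  obtain ⟨Q, U, hQ, hU, hQU, hdecomp⟩ := exists_barycentric_motion hP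
    (V := V) (by rw [hV, detDeriv, Matrix.mul_zero, trace_zero])
  have hU0 : U = 0 := by
    ext i j
    by_cases hj : j ∈ (initialSimplex hn).1
    · obtain ⟨k, rfl⟩ := mem_initialSimplex.1 hj
      exact congrFun (congrFun hU i) k
    · refine apply_eq_zero_of_detDeriv_exchange hQ hU hj ?_
      have := h (exchange hn i j hj)
      rw [hQU] at this
      exact (mul_eq_zero.1 this).resolve_left hP
  rw [hdecomp, hV, hU0]
  simp

/-- In a generic configuration the points of the initial simplex are affinely independent. -/
theorem det_initialSimplex_ne_zero {n d : ℕ} (hn : d + 1 ≤ n) {p : Configuration n d}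
    (hp : IsGeneric p) : ((homogeneousMatrix p).submatrix id (Fin.castLE hn)).det ≠ 0 := by
  set f : MvPolynomial (Fin n × Fin d) ℚ := (configurationMatrix
    (fun i c => MvPolynomial.X (R := ℚ) (i, c)) (initialSimplex hn)).det with hf
  have key : ∀ {R : Type} [CommRing R] [Algebra ℚ R] (q : Fin n → Fin d → R),
      MvPolynomial.aeval (fun x : Fin n × Fin d => q x.1 x.2) f =
        (configurationMatrix q (initialSimplex hn)).det := by
    intro R _ _ q
    rw [hf, AlgHom.map_det]
    congr 1
    ext r c
    refine Fin.cases ?_ (fun r => ?_) r <;> simp [configurationMatrix]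
  have hf0 : f ≠ 0 := by
    intro h0
    -- at the origin and the unit vectors the matrix is unitriangular
    have h1 := key (R := ℚ) (fun x c => if x.1 = c.1 + 1 then 1 else 0)
    rw [h0, map_zero, det_of_isUpperTriangular] at h1
    · refine zero_ne_one (h1.trans (Finset.prod_eq_one fun r _ => ?_))
      rw [configurationMatrix, vertex_initialSimplex]
      refine Fin.cases ?_ (fun r => ?_) r <;> simp
    · intro r c hrc
      rw [configurationMatrix, vertex_initialSimplex]
      replace hrc : c < r := hrc
      revert hrc
      refine Fin.cases ?_ (fun r => ?_) r
      · intro h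
        exact absurd h (Fin.not_lt_zero c)
      · intro h
        have : c.1 < r.1 + 1 := h
        simp [this.ne]
  have := hp f hf0
  rw [key p] at this
  rwa [← vertex_initialSimplex]

/-! ### The model faces -/

/-- The `k`-simplices with at most one vertex outside the initial `d`-simplex; for `k = d` they are
moreover required to contain the first vertex. They turn out to be the `k`-simplices of the
lexicographically greedy rigid complex. -/
def modelFaces {n d : ℕ} (hn : d + 1 ≤ n) (k : ℕ) : Finset (Simplex n k) :=
  {A | (A.1 \ (initialSimplex hn).1).card ≤ 1 ∧ (k = d → Fin.castLE hn 0 ∈ A.1)}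

theorem mem_modelFaces {n d k : ℕ} {hn : d + 1 ≤ n} {A : Simplex n k} :
    A ∈ modelFaces hn k ↔
      (A.1 \ (initialSimplex hn).1).card ≤ 1 ∧ (k = d → Fin.castLE hn 0 ∈ A.1) := by
  simp [modelFaces]

theorem initialSimplex_mem_modelFaces {n d : ℕ} {hn : d + 1 ≤ n} :
    initialSimplex hn ∈ modelFaces hn d := by
  simp [mem_modelFaces, castLE_mem_initialSimplex]

theorem card_initialSimplex_sdiff {n d : ℕ} {hn : d + 1 ≤ n} (S : Simplex n d) :
    ((initialSimplex hn).1 \ S.1).card = (S.1 \ (initialSimplex hn).1).card :=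
  Finset.card_sdiff_comm ((initialSimplex hn).2.trans S.2.symm)

theorem eq_initialSimplex_or_exchange {n d : ℕ} {hn : d + 1 ≤ n} {A : Simplex n d}
    (hA : A ∈ modelFaces hn d) :
    A = initialSimplex hn ∨ ∃ i j hj, i ≠ 0 ∧ A = exchange hn i j hj := by
  obtain ⟨hcard, h0⟩ := mem_modelFaces.1 hA
  rcases Nat.lt_or_eq_of_le hcard with hlt | heq
  · left
    refine Subtype.ext (Finset.eq_of_subset_of_card_le ?_ ?_)
    · rw [← Finset.sdiff_eq_empty_iff_subset, ← Finset.card_eq_zero]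
      omega
    · rw [A.2, (initialSimplex hn).2]
  · right
    obtain ⟨j, hj⟩ := Finset.card_eq_one.1 heq
    obtain ⟨x, hx⟩ := Finset.card_eq_one.1 ((card_initialSimplex_sdiff A).trans heq)
    have hx' : x ∈ (initialSimplex hn).1 \ A.1 := hx ▸ Finset.mem_singleton_self x
    have hj' : j ∈ A.1 \ (initialSimplex hn).1 := hj ▸ Finset.mem_singleton_self j
    rw [Finset.mem_sdiff] at hx' hj'
    obtain ⟨i, rfl⟩ := mem_initialSimplex.1 hx'.1
    refine ⟨i, j, hj'.2, ?_, Subtype.ext ?_⟩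
    · rintro rfl
      exact hx'.2 (h0 rfl)
    · ext y
      have h1 := Finset.ext_iff.1 hj y
      have h2 := Finset.ext_iff.1 hx y
      simp only [Finset.mem_sdiff, Finset.mem_singleton] at h1 h2
      simp only [exchange, Finset.mem_insert, Finset.mem_erase]
      tauto

/-- The greedy basis consists of model faces: if `S` has two vertices outside the initial simplex,
then the initial simplex and its neighbours that miss a vertex not in `S` precede `S`, and if `S`
lacks the first vertex, then all `d`-simplices with the first vertex precede `S`. In both cases the
preceding ones already span `S`. -/
theorem lexGreedyBasis_subset_modelFaces {n d : ℕ} (hn : d + 1 ≤ n) {S : Simplex n d}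
    (hS : S ∈ lexGreedyBasis n d) : S ∈ modelFaces hn d := by
  have hp := (exists_isGeneric n d).choose_spec
  have hdet := det_initialSimplex_ne_zero hn hp
  have hclosure : ∀ X : Set (Simplex n d), (∀ v : Configuration n d,
      (∀ T ∈ X, detDeriv ((homogeneousMatrix (genericConfiguration n d)).submatrix id T.vertex)
        ((velocityMatrix v).submatrix id T.vertex) = 0) →
      detDeriv ((homogeneousMatrix (genericConfiguration n d)).submatrix id S.vertex)
        ((velocityMatrix v).submatrix id S.vertex) = 0) →
      S ∈ (rigidityMatroid n d).closure X := by
    intro X hX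
    refine mem_closure_rowMatroid_of_forall _ fun v hv => ?_
    rw [rigidityMatrix_dotProduct _ (fun i c => v (i, c))]
    refine hX _ fun T hT => ?_
    rw [← rigidityMatrix_dotProduct]
    exact hv T hT
  rw [mem_modelFaces]
  by_contra hcon
  refine hS (hclosure _ fun v hv => ?_)
  by_cases hcard : (S.1 \ (initialSimplex hn).1).card ≤ 1
  · have h0 : Fin.castLE hn 0 ∉ S.1 := fun h => hcon ⟨hcard, fun _ => h⟩
    have hlt : ∀ T : Simplex n d, Fin.castLE hn 0 ∈ T.1 → T.LexLT S := fun T hT =>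
      Simplex.lexLT_of_mem hT h0 fun y hy => absurd (show y.1 < 0 from hy) (Nat.not_lt_zero _)
    refine detDeriv_eq_zero_of_exchange_ne_zero hdet (fun x => rfl) (fun x => rfl) ?_ S ?_
    · rw [← vertex_initialSimplex]
      exact hv _ (hlt _ (castLE_mem_initialSimplex 0))
    · intro i j hj hi
      refine hv _ (hlt _ (Finset.mem_insert_of_mem (Finset.mem_erase.2
        ⟨fun h => hi ?_, castLE_mem_initialSimplex 0⟩)))
      exact (Fin.castLE_injective hn h).symm
  · -- every vertex before a missing vertex `x` of the initial simplex is in the initial simplex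
    have hlow : ∀ x ∈ (initialSimplex hn).1, ∀ y < x, y ∈ (initialSimplex hn).1 :=
      fun x hx y hy => mem_initialSimplex_iff_lt.2
        (lt_trans (show y.1 < x.1 from hy) (mem_initialSimplex_iff_lt.1 hx))
    rw [← card_initialSimplex_sdiff, not_le] at hcard
    refine detDeriv_eq_zero_of_exchange hdet ?_ S ?_
    · obtain ⟨x, hx⟩ := Finset.card_pos.1 (zero_lt_one.trans hcard)
      rw [Finset.mem_sdiff] at hx
      rw [← vertex_initialSimplex]
      exact hv _ (Simplex.lexLT_of_mem hx.1 hx.2 fun y hy _ => hlow x hx.1 y hy)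
    · intro i j hj hi
      obtain ⟨x, hx, hxi⟩ := Finset.exists_mem_ne hcard (Fin.castLE hn i)
      rw [Finset.mem_sdiff] at hx
      refine hv _ (Simplex.lexLT_of_mem (x := x)
        (Finset.mem_insert_of_mem (Finset.mem_erase.2 ⟨hxi, hx.1⟩)) hx.2 fun y hy hyS => ?_)
      refine Finset.mem_insert_of_mem (Finset.mem_erase.2 ⟨?_, hlow x hx.1 y hy⟩)
      rintro rfl
      exact hi hyS

/-! ### Minors of a completed coordinate matrix -/

theorem exists_det_submatrix_eq_mul {n k : ℕ} {a : Fin (k + 1) → Fin n}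
    (ha : Function.Injective a) {A : Simplex n k} (hA : ∀ r, a r ∈ A.1) :
    ∃ ε : ℝ, ε ≠ 0 ∧ ∀ (M : Matrix (Fin n) (Fin n) ℝ) (s : Fin (k + 1) → Fin n),
      (M.submatrix a s).det = ε * (M.submatrix A.vertex s).det := by
  choose σ hσ using fun r => A.mem_iff_exists_vertex.1 (hA r)
  have hinj : Function.Injective σ := fun r r' h => ha (by rw [← hσ r, ← hσ r', h])
  let e : Equiv.Perm (Fin (k + 1)) := Equiv.ofBijective σ (Finite.injective_iff_bijective.1 hinj)
  refine ⟨(Equiv.Perm.sign e : ℤ), by exact_mod_cast (Equiv.Perm.sign e).ne_zero, fun M s => ?_⟩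
  have : M.submatrix a s = (M.submatrix A.vertex s).submatrix e id := by
    ext r c
    simp only [submatrix_apply, id, ← hσ r]
    rfl
  rw [this, det_permute]

/-- The face of a simplex opposite to its `c`-th vertex. -/
def Simplex.face {n k : ℕ} (S : Simplex n (k + 1)) (c : Fin (k + 2)) : Simplex n k :=
  ⟨S.1.erase (S.vertex c), by
    rw [Finset.card_erase_of_mem (S.mem_iff_exists_vertex.2 ⟨c, rfl⟩), S.2]
    omega⟩

theorem Simplex.vertex_face {n k : ℕ} (S : Simplex n (k + 1)) (c : Fin (k + 2)) :
    (S.face c).vertex = S.vertex ∘ c.succAbove := by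
  refine (Finset.orderEmbOfFin_unique _ (fun i => ?_) ?_).symm
  · refine Finset.mem_erase.2 ⟨fun h => ?_, S.mem_iff_exists_vertex.2 ⟨_, rfl⟩⟩
    exact Fin.succAbove_ne c i (S.vertex_injective h)
  · exact (S.1.orderEmbOfFin S.2).strictMono.comp (Fin.strictMono_succAbove c)

/-- If a linear combination of minors vanishes on all `k`-simplices of a complex, then its product
with a further row vanishes on all `(k + 1)`-simplices, by Laplace expansion. -/
theorem sum_det_cons_eq_zero {n k : ℕ} (K : PreAbstractSimplicialComplex (Fin n))
    (M : Matrix (Fin n) (Fin n) ℝ) (F : Finset (Simplex n k)) (g : Simplex n k → ℝ)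
    (h : ∀ B ∈ simplices K k, ∑ A ∈ F, g A * (M.submatrix A.vertex B.vertex).det = 0)
    (x : Fin n) {S : Simplex n (k + 1)} (hS : S ∈ simplices K (k + 1)) :
    ∑ A ∈ F, g A * (M.submatrix (Fin.cons x A.vertex : Fin (k + 2) → Fin n) S.vertex).det = 0 := by
  have hlap : ∀ A : Simplex n k,
      (M.submatrix (Fin.cons x A.vertex : Fin (k + 2) → Fin n) S.vertex).det =
        ∑ c : Fin (k + 2), (-1) ^ (c : ℕ) * M x (S.vertex c) *
          (M.submatrix A.vertex (S.face c).vertex).det := by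
    intro A
    rw [det_succ_row_zero]
    refine Finset.sum_congr rfl fun c _ => ?_
    rw [S.vertex_face]
    rfl
  simp only [hlap, Finset.mul_sum]
  rw [Finset.sum_comm]
  refine Finset.sum_eq_zero fun c _ => ?_
  have hface : S.face c ∈ simplices K k := by
    have hne : (S.face c).1.Nonempty := Finset.card_pos.1 (by rw [(S.face c).2]; omega)
    exact (K.isRelLowerSet_faces hS).2 (Finset.erase_subset _ _) hne
  have := h _ hface
  calc _ = ((-1) ^ (c : ℕ) * M x (S.vertex c)) *
        ∑ A ∈ F, g A * (M.submatrix A.vertex (S.face c).vertex).det := by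
        rw [Finset.mul_sum]
        exact Finset.sum_congr rfl fun A _ => by ring
    _ = 0 := by rw [this, mul_zero]

/-- The minors of `M` with rows in a model `k`-face and columns in a `k`-simplex of `K` form linearly
independent vectors, indexed by the model faces. -/
def MinorsIndependent {n d : ℕ} (hn : d + 1 ≤ n) (K : PreAbstractSimplicialComplex (Fin n))
    (M : Matrix (Fin n) (Fin n) ℝ) (k : ℕ) : Prop :=
  ∀ g : Simplex n k → ℝ, (∀ B ∈ simplices K k,
    ∑ A ∈ modelFaces hn k, g A * (M.submatrix A.vertex B.vertex).det = 0) →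
    ∀ A ∈ modelFaces hn k, g A = 0

theorem MinorsIndependent.card_le_faceNumber {n d : ℕ} {hn : d + 1 ≤ n}
    {K : PreAbstractSimplicialComplex (Fin n)} {M : Matrix (Fin n) (Fin n) ℝ} {k : ℕ}
    (h : MinorsIndependent hn K M k) : (modelFaces hn k).card ≤ faceNumber K k := by
  classical
  have := Fintype.ofFinite (simplices K k)
  have hli : LinearIndepOn ℝ (fun (A : Simplex n k) (B : simplices K k) =>
      (M.submatrix A.vertex B.1.vertex).det) (modelFaces hn k : Set (Simplex n k)) := by
    rw [linearIndepOn_finset_iff]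
    intro g hg
    refine h g fun B hB => ?_
    simpa using congrFun hg ⟨B, hB⟩
  have hcard := LinearIndependent.fintype_card_le_finrank hli
  rw [Module.finrank_fintype_fun_eq_card] at hcard
  rw [faceNumber, Set.ncard_eq_toFinset_card', Set.toFinset_card]
  simpa using hcard

theorem insert_sdiff_initialSimplex {n d : ℕ} {hn : d + 1 ≤ n} (A : Finset (Fin n))
    {x : Fin n} (hx : x ∈ (initialSimplex hn).1) :
    insert x A \ (initialSimplex hn).1 = A \ (initialSimplex hn).1 :=
  Finset.insert_sdiff_of_mem A hx

/-- Multiplication by a row `x` of the initial simplex isolates the coefficients of the model faces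
that do not contain `x`. -/
theorem MinorsIndependent.apply_eq_zero_of_notMem {n d : ℕ} {hn : d + 1 ≤ n}
    {K : PreAbstractSimplicialComplex (Fin n)} {M : Matrix (Fin n) (Fin n) ℝ} {k : ℕ}
    (h : MinorsIndependent hn K M (k + 1)) {g : Simplex n k → ℝ}
    (hg : ∀ B ∈ simplices K k,
      ∑ A ∈ modelFaces hn k, g A * (M.submatrix A.vertex B.vertex).det = 0)
    {x : Fin n} (hx : x ∈ (initialSimplex hn).1)
    (h0 : ∀ A ∈ modelFaces hn k, x ∉ A.1 → g A ≠ 0 → k + 1 = d → Fin.castLE hn 0 ∈ insert x A.1)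
    {A : Simplex n k} (hA : A ∈ modelFaces hn k) (hxA : x ∉ A.1) : g A = 0 := by
  classical
  by_contra hgA
  -- the sign of the permutation that sorts the tuple `x, A`
  have hins : ∀ A : Simplex n k, ∃ ε : ℝ, x ∉ A.1 → ε ≠ 0 ∧
      ∀ A' : Simplex n (k + 1), A'.1 = insert x A.1 → ∀ s : Fin (k + 2) → Fin n,
        (M.submatrix (Fin.cons x A.vertex : Fin (k + 2) → Fin n) s).det =
          ε * (M.submatrix A'.vertex s).det := by
    intro A
    by_cases hxA : x ∈ A.1
    · exact ⟨0, fun h => absurd hxA h⟩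
    · let A₁ : Simplex n (k + 1) := ⟨insert x A.1, by rw [Finset.card_insert_of_notMem hxA, A.2]⟩
      have hinj : Function.Injective (Fin.cons x A.vertex : Fin (k + 2) → Fin n) := by
        rw [Fin.cons_injective_iff]
        refine ⟨?_, A.vertex_injective⟩
        rintro ⟨c, hc⟩
        exact hxA (A.mem_iff_exists_vertex.2 ⟨c, hc⟩)
      obtain ⟨ε, hε, hεM⟩ := exists_det_submatrix_eq_mul hinj (A := A₁) (by
        intro r
        refine Fin.cases ?_ (fun r => ?_) r
        · exact Finset.mem_insert_self _ _
        · exact Finset.mem_insert_of_mem (A.mem_iff_exists_vertex.2 ⟨r, rfl⟩))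
      refine ⟨ε, fun _ => ⟨hε, fun A' hA' => ?_⟩⟩
      obtain rfl : A' = A₁ := Subtype.ext hA'
      exact hεM M
  choose ε hε using hins
  set F := (modelFaces hn k).filter fun A => x ∉ A.1 ∧ g A ≠ 0 with hF
  have hmodel : ∀ A ∈ F, ∀ A' : Simplex n (k + 1), A'.1 = insert x A.1 →
      A' ∈ modelFaces hn (k + 1) := by
    intro A hAF A' hA'
    obtain ⟨hAm, hxA, hgA⟩ := Finset.mem_filter.1 hAF
    rw [mem_modelFaces, hA', insert_sdiff_initialSimplex _ hx]
    exact ⟨(mem_modelFaces.1 hAm).1, h0 A hAm hxA hgA⟩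
  have key := h (fun A' => ∑ A ∈ F, if A'.1 = insert x A.1 then g A * ε A else 0) ?_
    ⟨insert x A.1, by rw [Finset.card_insert_of_notMem hxA, A.2]⟩
    (hmodel A (Finset.mem_filter.2 ⟨hA, hxA, hgA⟩) _ rfl)
  · rw [Finset.sum_eq_single A] at key
    · rw [if_pos rfl] at key
      exact (mul_ne_zero hgA (hε A hxA).1) key
    · intro A₂ hA₂ hne
      refine if_neg fun heq => hne (Subtype.ext ?_)
      have hxA₂ := (Finset.mem_filter.1 hA₂).2.1
      rw [← Finset.erase_insert hxA₂, ← Finset.erase_insert hxA]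
      exact congrArg (fun B => Finset.erase B x) heq.symm
    · exact fun hA' => absurd (Finset.mem_filter.2 ⟨hA, hxA, hgA⟩) hA'
  · intro S hS
    refine Eq.trans ?_ (sum_det_cons_eq_zero K M (modelFaces hn k) g hg x hS)
    have hterm : ∀ A ∈ modelFaces hn k, g A * (M.submatrix
        (Fin.cons x A.vertex : Fin (k + 2) → Fin n) S.vertex).det ≠ 0 → x ∉ A.1 ∧ g A ≠ 0 := by
      intro A _ hne
      refine ⟨fun hxA => right_ne_zero_of_mul hne ?_, left_ne_zero_of_mul hne⟩
      obtain ⟨c, hc⟩ := A.mem_iff_exists_vertex.1 hxA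
      refine det_zero_of_row_eq (Fin.succ_ne_zero c).symm ?_
      funext y
      simp [hc]
    rw [← Finset.sum_filter_of_ne hterm]
    simp only [Finset.sum_mul]
    rw [Finset.sum_comm]
    refine Finset.sum_congr rfl fun A hAF => ?_
    have hxA := (Finset.mem_filter.1 hAF).2.1
    let A₁ : Simplex n (k + 1) := ⟨insert x A.1, by rw [Finset.card_insert_of_notMem hxA, A.2]⟩
    rw [Finset.sum_eq_single A₁]
    · rw [if_pos rfl, (hε A hxA).2 A₁ rfl, mul_assoc]
    · intro A' _ hne
      rw [if_neg fun heq => hne (Subtype.ext heq), zero_mul]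
    · exact fun hA₁ => absurd (hmodel A hAF A₁ rfl) hA₁

/-- Multiplying first by the row of the first vertex leaves only model faces that contain it, and
these can then be multiplied by any row of the initial simplex. -/
theorem MinorsIndependent.of_succ {n d : ℕ} {hn : d + 1 ≤ n}
    {K : PreAbstractSimplicialComplex (Fin n)} {M : Matrix (Fin n) (Fin n) ℝ} {k : ℕ} (hk : k < d)
    (h : MinorsIndependent hn K M (k + 1)) : MinorsIndependent hn K M k := by
  intro g hg A hA
  have hfirst : ∀ A ∈ modelFaces hn k, Fin.castLE hn 0 ∉ A.1 → g A = 0 := fun A hA h0 =>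
    h.apply_eq_zero_of_notMem hg (castLE_mem_initialSimplex 0)
      (fun _ _ _ _ _ => Finset.mem_insert_self _ _) hA h0
  obtain ⟨x, hx, hxA⟩ := Finset.exists_mem_notMem_of_card_lt_card
    (show A.1.card < (initialSimplex hn).1.card by rw [A.2, (initialSimplex hn).2]; omega)
  refine h.apply_eq_zero_of_notMem hg hx (fun B hB _ hgB _ => ?_) hA hxA
  by_contra h0
  exact hgB (hfirst B hB fun h' => h0 (Finset.mem_insert_of_mem h'))

/-- The coordinate matrix `P`, completed by the rows of the identity matrix that belong to the
vertices outside the initial simplex. -/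
def completedMatrix {n d : ℕ} (P : Matrix (Fin (d + 1)) (Fin n) ℝ) : Matrix (Fin n) (Fin n) ℝ :=
  Matrix.of fun i x => if h : i.1 < d + 1 then P ⟨i.1, h⟩ x else (1 : Matrix _ _ ℝ) i x

theorem completedMatrix_castLE {n d : ℕ} {hn : d + 1 ≤ n} (P : Matrix (Fin (d + 1)) (Fin n) ℝ)
    (i : Fin (d + 1)) (x : Fin n) : completedMatrix P (Fin.castLE hn i) x = P i x := by
  exact dif_pos i.2

theorem completedMatrix_of_notMem {n d : ℕ} {hn : d + 1 ≤ n} (P : Matrix (Fin (d + 1)) (Fin n) ℝ)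
    {j : Fin n} (hj : j ∉ (initialSimplex hn).1) (x : Fin n) :
    completedMatrix P j x = (1 : Matrix _ _ ℝ) j x := by
  rw [mem_initialSimplex_iff_lt] at hj
  exact dif_neg hj

/-- The minors with rows in the initial simplex are derivatives of the volumes along the motion that
scales the first coordinate. -/
theorem exists_motion_initialSimplex {n d : ℕ} (hd : 1 ≤ d) (hn : d + 1 ≤ n)
    (P : Matrix (Fin (d + 1)) (Fin n) ℝ) :
    ∃ V : Matrix (Fin (d + 1)) (Fin n) ℝ, (∀ x, V 0 x = 0) ∧ ∀ s : Fin (d + 1) → Fin n,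
      detDeriv (P.submatrix id s) (V.submatrix id s) =
        ((completedMatrix P).submatrix (initialSimplex hn).vertex s).det := by
  let i : Fin (d + 1) := ⟨1, by omega⟩
  have hi : (0 : Fin (d + 1)) ≠ i := by simp [i, Fin.ext_iff]
  refine ⟨(0 : Matrix _ _ ℝ).updateRow i (P i), fun x => by simp [hi], fun s => ?_⟩
  have h1 : ((0 : Matrix (Fin (d + 1)) (Fin n) ℝ).updateRow i (P i)).submatrix id s =
      (0 : Matrix (Fin (d + 1)) (Fin (d + 1)) ℝ).updateRow i ((P.submatrix id s) i) := by
    ext r c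
    by_cases hr : r = i
    · subst hr; simp
    · simp [hr]
  have h2 : (completedMatrix P).submatrix (initialSimplex hn).vertex s = P.submatrix id s := by
    ext r c
    rw [vertex_initialSimplex, submatrix_apply, completedMatrix_castLE]
    rfl
  rw [h1, detDeriv_updateRow, updateRow_eq_self, h2]

/-- The minors with rows in a neighbour of the initial simplex are derivatives of the volumes along a
motion of the exchanged vertex in one coordinate direction. -/
theorem exists_motion_exchange {n d : ℕ} (hn : d + 1 ≤ n) (P : Matrix (Fin (d + 1)) (Fin n) ℝ)
    (i : Fin (d + 1)) {j : Fin n} (hj : j ∉ (initialSimplex hn).1) :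
    ∃ ε : ℝ, ε ≠ 0 ∧ ∀ s : Fin (d + 1) → Fin n,
      detDeriv (P.submatrix id s) ((Matrix.single i j ε).submatrix id s) =
        ((completedMatrix P).submatrix (exchange hn i j hj).vertex s).det := by
  have hinj : Function.Injective (Function.update (Fin.castLE hn) i j) := by
    intro r r' h
    have hne : ∀ r, Fin.castLE hn r ≠ j := fun r h => hj (h ▸ castLE_mem_initialSimplex r)
    by_cases hr : r = i <;> by_cases hr' : r' = i
    · rw [hr, hr']
    · subst hr
      rw [Function.update_self, Function.update_of_ne hr'] at h
      exact absurd h.symm (hne r')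
    · subst hr'
      rw [Function.update_self, Function.update_of_ne hr] at h
      exact absurd h (hne r)
    · rw [Function.update_of_ne hr, Function.update_of_ne hr'] at h
      exact Fin.castLE_injective hn h
  obtain ⟨ε, hε, hεM⟩ := exists_det_submatrix_eq_mul hinj (A := exchange hn i j hj) (by
    intro r
    by_cases hr : r = i
    · subst hr
      rw [Function.update_self]
      exact Finset.mem_insert_self _ _
    · rw [Function.update_of_ne hr]
      refine Finset.mem_insert_of_mem (Finset.mem_erase.2 ⟨fun h => hr ?_,
        castLE_mem_initialSimplex r⟩)
      exact Fin.castLE_injective hn h)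
  refine ⟨ε⁻¹, inv_ne_zero hε, fun s => ?_⟩
  have h1 : (Matrix.single i j ε⁻¹).submatrix id s = ε⁻¹ •
      (0 : Matrix (Fin (d + 1)) (Fin (d + 1)) ℝ).updateRow i
        (fun c => (1 : Matrix (Fin n) (Fin n) ℝ) j (s c)) := by
    ext r c
    by_cases hr : r = i
    · subst hr; simp [Matrix.single_apply, one_apply]
    · simp [hr, Ne.symm hr]
  have h2 : (completedMatrix P).submatrix (Function.update (Fin.castLE hn) i j) s =
      (P.submatrix id s).updateRow i (fun c => (1 : Matrix (Fin n) (Fin n) ℝ) j (s c)) := by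
    ext r c
    by_cases hr : r = i
    · subst hr
      simp [completedMatrix_of_notMem P hj]
    · simp [hr, completedMatrix_castLE]
  rw [h1, detDeriv_smul, detDeriv_updateRow, ← h2, hεM, inv_mul_cancel_left₀ hε]

/-- If the `d`-simplices of `K` form a basis, then the minors with rows in the model `d`-faces are
linearly independent on `K`: a combination of them is the derivative of the volumes along a motion,
which vanishes on `K` only if it vanishes on all simplices. -/
theorem minorsIndependent_of_isBase {n d : ℕ} (hd : 1 ≤ d) (hn : d + 1 ≤ n)
    {K : PreAbstractSimplicialComplex (Fin n)}
    (hK : (rigidityMatroid n d).IsBase (simplices K d)) :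
    MinorsIndependent hn K (completedMatrix (homogeneousMatrix (genericConfiguration n d))) d := by
  set P := homogeneousMatrix (genericConfiguration n d) with hP
  have hdet : (P.submatrix id (Fin.castLE hn)).det ≠ 0 :=
    det_initialSimplex_ne_zero hn (exists_isGeneric n d).choose_spec
  intro g hg
  obtain ⟨V₀, hV₀0, hV₀⟩ := exists_motion_initialSimplex hd hn P
  have hmotion : ∀ A : Simplex n d, ∃ V : Matrix (Fin (d + 1)) (Fin n) ℝ, A ∈ modelFaces hn d →
      (∀ x, V 0 x = 0) ∧ (∀ s : Fin (d + 1) → Fin n,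
        detDeriv (P.submatrix id s) (V.submatrix id s) =
          ((completedMatrix P).submatrix A.vertex s).det) ∧
      (A ≠ initialSimplex hn → ∃ i j hj, A = exchange hn i j hj ∧
        ∃ ε : ℝ, ε ≠ 0 ∧ V = Matrix.single i j ε) := by
    intro A
    by_cases hA : A ∈ modelFaces hn d
    · rcases eq_initialSimplex_or_exchange hA with rfl | ⟨i, j, hj, hi, rfl⟩
      · exact ⟨V₀, fun _ => ⟨hV₀0, hV₀, fun h => absurd rfl h⟩⟩
      · obtain ⟨ε, hε, hεV⟩ := exists_motion_exchange hn P i hj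
        exact ⟨Matrix.single i j ε, fun _ => ⟨fun x => by simp [hi], hεV,
          fun _ => ⟨i, j, hj, rfl, ε, hε, rfl⟩⟩⟩
    · exact ⟨0, fun h => absurd h hA⟩
  choose V hV using hmotion
  set W := ∑ A ∈ modelFaces hn d, g A • V A with hW
  have hWs : ∀ s : Fin (d + 1) → Fin n, detDeriv (P.submatrix id s) (W.submatrix id s) =
      ∑ A ∈ modelFaces hn d, g A * ((completedMatrix P).submatrix A.vertex s).det := by
    intro s
    let L : Matrix (Fin (d + 1)) (Fin n) ℝ →+ ℝ :=
      AddMonoidHom.mk' (fun Y => detDeriv (P.submatrix id s) (Y.submatrix id s))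
        fun Y Z => detDeriv_add _ _ _
    have hL : detDeriv (P.submatrix id s) (W.submatrix id s) = L W := rfl
    rw [hL, hW, map_sum]
    refine Finset.sum_congr rfl fun A hA => ?_
    rw [← (hV A hA).2.1 s, ← detDeriv_smul]
    rfl
  have hW0 : ∀ x, W 0 x = 0 := by
    intro x
    rw [hW, Matrix.sum_apply]
    refine Finset.sum_eq_zero fun A hA => ?_
    rw [Matrix.smul_apply, (hV A hA).1, smul_zero]
  -- the combination vanishes on the basis, hence on all simplices
  have hall : ∀ S : Simplex n d,
      detDeriv (P.submatrix id S.vertex) (W.submatrix id S.vertex) = 0 := by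
    have hWv : W = velocityMatrix fun x c => W c.succ x := by
      ext r x
      refine Fin.cases ?_ (fun r => ?_) r
      · exact hW0 x
      · rfl
    intro S
    rw [hWv, hP, ← rigidityMatrix_dotProduct]
    refine dotProduct_eq_zero_of_isBase _ hK (fun x => W x.2.succ x.1) (fun T hT => ?_) S
    rw [rigidityMatrix_dotProduct _ (fun x c => W c.succ x), ← hWv, ← hP, hWs]
    exact hg T hT
  -- on the initial simplex only its own minor is nonzero
  have hexch : ∀ A ∈ modelFaces hn d, A ≠ initialSimplex hn → ∀ r k,
      V A r (Fin.castLE hn k) = 0 := by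
    intro A hA hne r k
    obtain ⟨i, j, hj, -, ε, -, hVA⟩ := (hV A hA).2.2 hne
    have : j ≠ Fin.castLE hn k := fun h => hj (h ▸ castLE_mem_initialSimplex k)
    simp [hVA, this]
  have hinit : g (initialSimplex hn) = 0 := by
    have h := hall (initialSimplex hn)
    rw [hWs, Finset.sum_eq_single_of_mem _ initialSimplex_mem_modelFaces] at h
    · refine (mul_eq_zero.1 h).resolve_right ?_
      rw [vertex_initialSimplex]
      have : (completedMatrix P).submatrix (Fin.castLE hn) (Fin.castLE hn) =
          P.submatrix id (Fin.castLE hn) := by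
        ext r c
        exact completedMatrix_castLE P r _
      rwa [this]
    · intro A hA hne
      have hzero : (V A).submatrix id (initialSimplex hn).vertex = 0 := by
        ext r c
        rw [vertex_initialSimplex]
        exact hexch A hA hne r c
      rw [← (hV A hA).2.1, hzero, detDeriv, Matrix.mul_zero, trace_zero, mul_zero]
  have hWzero : W = 0 := by
    refine eq_zero_of_detDeriv_eq_zero hdet ?_ hall
    ext r c
    rw [submatrix_apply, hW, Matrix.sum_apply]
    refine Finset.sum_eq_zero fun A hA => ?_
    rw [Matrix.smul_apply]
    by_cases hne : A = initialSimplex hn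
    · rw [hne, hinit, zero_smul]
    · rw [hexch A hA hne, smul_zero]
  intro A hA
  by_cases hne : A = initialSimplex hn
  · rw [hne, hinit]
  obtain ⟨i, j, hj, hAij, ε, hε, hVA⟩ := (hV A hA).2.2 hne
  have hentry := congrFun (congrFun hWzero i) j
  rw [hW, Matrix.sum_apply, Finset.sum_eq_single_of_mem A hA] at hentry
  · rw [Matrix.smul_apply, hVA, Matrix.single_apply_same] at hentry
    exact (mul_eq_zero.1 hentry).resolve_right hε
  · intro B hB hBA
    rw [Matrix.smul_apply]
    by_cases hB0 : B = initialSimplex hn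
    · rw [hB0, hinit, zero_smul]
    · obtain ⟨i', j', hj', hBij, ε', -, hVB⟩ := (hV B hB).2.2 hB0
      rw [hVB, Matrix.single_apply_of_ne, smul_zero]
      rintro ⟨rfl, rfl⟩
      exact hBA (hBij.trans hAij.symm)

theorem card_modelFaces_le_faceNumber {n d : ℕ} (hd : 1 ≤ d) (hn : d + 1 ≤ n)
    {K : PreAbstractSimplicialComplex (Fin n)}
    (hK : (rigidityMatroid n d).IsBase (simplices K d)) {k : ℕ} (hk : k ≤ d) :
    (modelFaces hn k).card ≤ faceNumber K k := by
  refine MinorsIndependent.card_le_faceNumber (M :=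
    completedMatrix (homogeneousMatrix (genericConfiguration n d))) ?_
  exact Nat.decreasingInduction' (P := MinorsIndependent hn K _)
    (fun _ hlt _ h => h.of_succ hlt) hk (minorsIndependent_of_isBase hd hn hK)

/-! ### Counting -/

theorem card_modelFaces_eq_add {n d : ℕ} (hn : d + 1 ≤ n) (k : ℕ) :
    (modelFaces hn k).card =
      (((initialSimplex hn).1.powersetCard (k + 1)).filter
        fun B => k = d → Fin.castLE hn 0 ∈ B).card +
      (n - d - 1) * (((initialSimplex hn).1.powersetCard k).filter
        fun B => k = d → Fin.castLE hn 0 ∈ B).card := by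
  set I := (initialSimplex hn).1 with hI
  have h0I : Fin.castLE hn 0 ∈ I := castLE_mem_initialSimplex 0
  have hcompl : (Iᶜ).card = n - d - 1 := by
    rw [Finset.card_compl, Fintype.card_fin, (initialSimplex hn).2]
    omega
  -- a model face is contained in `I`, or arises from a subset of `I` by adding a vertex outside
  have hsplit : (modelFaces hn k).map (Function.Embedding.subtype _) =
      (I.powersetCard (k + 1)).filter (fun B => k = d → Fin.castLE hn 0 ∈ B) ∪
      (Iᶜ ×ˢ (I.powersetCard k).filter (fun B => k = d → Fin.castLE hn 0 ∈ B)).image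
        fun x => insert x.1 x.2 := by
    ext A
    simp only [Finset.mem_map, Function.Embedding.coe_subtype, Finset.mem_union, Finset.mem_filter,
      Finset.mem_powersetCard, Finset.mem_image, Finset.mem_product, Finset.mem_compl, Prod.exists]
    constructor
    · rintro ⟨A, hA, rfl⟩
      obtain ⟨hcard, h0⟩ := mem_modelFaces.1 hA
      rcases Nat.lt_or_eq_of_le hcard with hlt | heq
      · left
        refine ⟨⟨?_, A.2⟩, h0⟩
        rw [← Finset.sdiff_eq_empty_iff_subset, ← Finset.card_eq_zero]
        exact Nat.lt_one_iff.1 hlt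
      · right
        obtain ⟨j, hj⟩ := Finset.card_eq_one.1 heq
        have hj' : j ∈ A.1 \ I := hj ▸ Finset.mem_singleton_self j
        rw [Finset.mem_sdiff] at hj'
        refine ⟨j, A.1.erase j, ⟨hj'.2, ⟨fun y hy => ?_, ?_⟩, fun hk => ?_⟩,
          Finset.insert_erase hj'.1⟩
        · rw [Finset.mem_erase] at hy
          by_contra hyI
          have : y ∈ A.1 \ I := Finset.mem_sdiff.2 ⟨hy.2, hyI⟩
          rw [hj, Finset.mem_singleton] at this
          exact hy.1 this
        · rw [Finset.card_erase_of_mem hj'.1, A.2]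
          rfl
        · exact Finset.mem_erase.2 ⟨fun h => hj'.2 (h ▸ h0I), h0 hk⟩
    · rintro (⟨⟨hAI, hcard⟩, h0⟩ | ⟨j, B, ⟨hj, ⟨hBI, hcard⟩, h0⟩, rfl⟩)
      · refine ⟨⟨A, hcard⟩, mem_modelFaces.2 ⟨?_, h0⟩, rfl⟩
        rw [Finset.sdiff_eq_empty_iff_subset.2 hAI, Finset.card_empty]
        exact zero_le_one
      · refine ⟨⟨insert j B, ?_⟩, mem_modelFaces.2
          ⟨?_, fun hk => Finset.mem_insert_of_mem (h0 hk)⟩, rfl⟩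
        · rw [Finset.card_insert_of_notMem fun h => hj (hBI h), hcard]
        · rw [← hI, Finset.insert_sdiff_of_notMem B hj, Finset.sdiff_eq_empty_iff_subset.2 hBI]
          exact (Finset.card_singleton j).le
  rw [← Finset.card_map (Function.Embedding.subtype _), hsplit, Finset.card_union_of_disjoint,
    Finset.card_image_of_injOn, Finset.card_product, hcompl]
  · rintro ⟨j, B⟩ hx ⟨j', B'⟩ hx' h
    simp only [Finset.coe_product, Set.mem_prod, Finset.mem_coe, Finset.mem_compl,
      Finset.mem_filter, Finset.mem_powersetCard] at hx hx' h
    have hjj : j = j' := by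
      have : j ∈ insert j' B' := h ▸ Finset.mem_insert_self j B
      exact (Finset.mem_insert.1 this).resolve_right fun hj => hx.1 (hx'.2.1.1 hj)
    subst hjj
    refine Prod.ext rfl ?_
    show B = B'
    rw [← Finset.erase_insert fun hj => hx.1 (hx.2.1.1 hj), h,
      Finset.erase_insert fun hj => hx.1 (hx'.2.1.1 hj)]
  · rw [Finset.disjoint_left]
    intro A hA hA'
    obtain ⟨⟨j, B⟩, hx, rfl⟩ := Finset.mem_image.1 hA'
    exact Finset.mem_compl.1 (Finset.mem_product.1 hx).1
      ((Finset.mem_powersetCard.1 (Finset.mem_filter.1 hA).1).1 (Finset.mem_insert_self _ _))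

theorem sum_range_choose_sub {d k : ℕ} (hk : k < d) :
    ∑ l ∈ Finset.range d, (if l ≤ k then (d - l).choose (k - l) else 0) = (d + 1).choose k := by
  induction d generalizing k with
  | zero => omega
  | succ d ih =>
    rw [Finset.sum_range_succ']
    cases k with
    | zero => simp
    | succ k =>
      simp only [add_le_add_iff_right, Nat.add_sub_add_right]
      rw [ih (by omega), Nat.choose_succ_succ (d + 1) k]
      simp

theorem card_modelFaces {n d : ℕ} (hn : d + 1 ≤ n) {k : ℕ} (hk : k ≤ d) :
    (modelFaces hn k).card = faceBound n d k := by
  have hcard := (initialSimplex hn).2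
  rw [card_modelFaces_eq_add, faceBound, ← Finset.mul_sum]
  rcases Nat.lt_or_eq_of_le hk with hlt | rfl
  · have htriv : ∀ s : Finset (Finset (Fin n)),
        s.filter (fun B => k = d → Fin.castLE hn 0 ∈ B) = s := fun s =>
      Finset.filter_true_of_mem fun B _ h => absurd h hlt.ne
    rw [htriv, htriv, Finset.card_powersetCard, Finset.card_powersetCard, hcard,
      sum_range_choose_sub hlt]
  · set I := (initialSimplex hn).1 with hI
    have h0I : Fin.castLE hn 0 ∈ I := castLE_mem_initialSimplex 0
    have hfacets : ((I.powersetCard k).filter fun B => Fin.castLE hn 0 ∈ B).card = k := by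
      have hnot : (I.powersetCard k).filter (fun B => ¬ Fin.castLE hn 0 ∈ B) =
          (I.erase (Fin.castLE hn 0)).powersetCard k := by
        ext B
        simp only [Finset.mem_filter, Finset.mem_powersetCard, Finset.subset_erase]
        tauto
      have h := Finset.card_filter_add_card_filter_not (s := I.powersetCard k)
        fun B => Fin.castLE hn 0 ∈ B
      rw [hnot, Finset.card_powersetCard, Finset.card_powersetCard, Finset.card_erase_of_mem h0I,
        hcard, Nat.add_sub_cancel, Nat.choose_self, Nat.choose_succ_self_right] at h
      omega
    have hsum : ∑ l ∈ Finset.range k, (if l ≤ k then (k - l).choose (k - l) else 0) = k := by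
      rw [Finset.sum_congr rfl (g := fun _ => 1)]
      · simp
      · intro l hl
        rw [if_pos (Finset.mem_range.1 hl).le, Nat.choose_self]
    rw [hsum, Nat.choose_self]
    simp only [forall_const, hfacets]
    have hself : I.powersetCard (k + 1) = {I} := by
      conv_lhs => rw [← hcard]
      exact Finset.powersetCard_self I
    rw [hself, Finset.filter_singleton, if_pos h0I, Finset.card_singleton]

/-! ### Face numbers of bases and of the greedy complex -/

theorem faceBound_le_faceNumber {n d : ℕ} (hd : 1 ≤ d) (hn : d + 1 ≤ n)
    {K : PreAbstractSimplicialComplex (Fin n)}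
    (hK : (rigidityMatroid n d).IsBase (simplices K d)) {k : ℕ} (hk : k ≤ d) :
    faceBound n d k ≤ faceNumber K k :=
  (card_modelFaces hn hk).symm.trans_le (card_modelFaces_le_faceNumber hd hn hK hk)

theorem simplices_lgrc (n d : ℕ) : simplices (lgrc n d) d = lexGreedyBasis n d := by
  ext S
  constructor
  · rintro ⟨-, T, hT, hST⟩
    have : S = T := Subtype.ext (Finset.eq_of_subset_of_card_le hST (by rw [S.2, T.2]))
    exact this ▸ hT
  · exact fun hS => ⟨Finset.card_pos.1 (by rw [S.2]; omega), S, hS, subset_rfl⟩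

theorem faceNumber_lgrc_le {n d : ℕ} (hn : d + 1 ≤ n) (k : ℕ) :
    faceNumber (lgrc n d) k ≤ (modelFaces hn k).card := by
  rw [faceNumber, ← Set.ncard_coe_finset]
  refine Set.ncard_le_ncard ?_ (Finset.finite_toSet _)
  intro A hA
  by_cases hk : k = d
  · subst hk
    rw [simplices_lgrc] at hA
    exact lexGreedyBasis_subset_modelFaces hn hA
  · obtain ⟨-, S, hS, hAS⟩ := hA
    refine mem_modelFaces.2 ⟨?_, fun h => absurd h hk⟩
    exact (Finset.card_le_card (Finset.sdiff_subset_sdiff hAS subset_rfl)).trans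
      (mem_modelFaces.1 (lexGreedyBasis_subset_modelFaces hn hS)).1

theorem hasDimension_lgrc {n d : ℕ} (h : (lexGreedyBasis n d).Nonempty) :
    HasDimension (lgrc n d) d := by
  constructor
  · rwa [Set.mem_ofPred_eq, simplices_lgrc]
  · rintro k ⟨A, -, S, -, hAS⟩
    have := Finset.card_le_card hAS
    rw [A.2, S.2] at this
    omega

end VolumeRigidity

theorem mainTheorem1 (n d : ℕ) (hd : 1 ≤ d) (hn : d + 1 ≤ n) :
    (∀ K : PreAbstractSimplicialComplex (Fin n),
      VolumeRigidity.HasDimension K d →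
      (VolumeRigidity.rigidityMatroid n d).IsBase (VolumeRigidity.simplices K d) →
      ∀ k ≤ d, VolumeRigidity.faceBound n d k ≤ VolumeRigidity.faceNumber K k) ∧
    (VolumeRigidity.HasDimension (VolumeRigidity.lgrc n d) d ∧
      (VolumeRigidity.rigidityMatroid n d).IsBase
        (VolumeRigidity.simplices (VolumeRigidity.lgrc n d) d) ∧
      ∀ k ≤ d, VolumeRigidity.faceNumber (VolumeRigidity.lgrc n d) k =
        VolumeRigidity.faceBound n d k) := by
  have hbase : (VolumeRigidity.rigidityMatroid n d).IsBase
      (VolumeRigidity.simplices (VolumeRigidity.lgrc n d) d) := by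
    rw [VolumeRigidity.simplices_lgrc]
    exact VolumeRigidity.lexGreedyBasis_isBase n d
  refine ⟨fun K _ hK k hk => VolumeRigidity.faceBound_le_faceNumber hd hn hK hk, ?_, hbase,
    fun k hk => le_antisymm ?_ (VolumeRigidity.faceBound_le_faceNumber hd hn hbase hk)⟩
  · refine VolumeRigidity.hasDimension_lgrc ?_
    have h := VolumeRigidity.faceBound_le_faceNumber hd hn hbase le_rfl
    rw [← VolumeRigidity.simplices_lgrc]
    refine Set.nonempty_of_ncard_ne_zero (Nat.pos_iff_ne_zero.1 (lt_of_lt_of_le ?_ h))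
    rw [VolumeRigidity.faceBound, Nat.choose_self]
    omega
  · rw [← VolumeRigidity.card_modelFaces hn hk]
    exact VolumeRigidity.faceNumber_lgrc_le hn k
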